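/- For an element $k$ of a field of characteristic $0$ put $$a(k)=5k^2-4k+4,\qquad b(k)=\tfrac12 k(k^2-4k+20),\qquad c(k)=\tfrac12 (k+2)(k^2-4),$$ and let $E_k$ be the curve $$E_k:\ y^2=\bigl(x+a(k)b(k)\bigr)\bigl(x+b(k)c(k)\bigr)\bigl(x+a(k)c(k)\bigr).$$ Then: 1. If $k$ is an indeterminate, $E_k$ is an elliptic curve over the function field $\mathbb{Q}(k)$, the point $P_k=(0,\,a(k)b(k)c(k))$ has infinite order in $E_k(\mathbb{Q}(k))$, and $\operatorname{rank} E_k(\mathbb{Q}(k))\ge 1$. 2. For every rational number $k\notin\{0,2,-2\}$, $E_k$ is an elliptic curve over $\mathbb{Q}$, the point $P_k=(0,\,a(k)b(k)c(k))$ has infinite order in $E_k(\mathbb{Q})$, and $\operatorname{rank} E_k(\mathbb{Q})\ge 1$. Here the rank of an abelian group is the maximal number of $\mathbb{Z}$-linearly independent elements. -/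

import Mathlib

noncomputable section

namespace HeronCurve

variable {K : Type*} [Field K]

/-- The side `a(k) = 5k² - 4k + 4`. -/
def sideA (k : K) : K := 5 * k ^ 2 - 4 * k + 4

/-- The side `b(k) = k(k² - 4k + 20)/2`. -/
def sideB (k : K) : K := k * (k ^ 2 - 4 * k + 20) / 2

/-- The side `c(k) = (k + 2)(k² - 4)/2`. -/
def sideC (k : K) : K := (k + 2) * (k ^ 2 - 4) / 2

/-- The Weierstrass curve `y² = (x + ab)(x + bc)(x + ac)`, with the right-hand side multiplied out:
`y² = x³ + (ab + bc + ac)x² + abc(a + b + c)x + (abc)²`. -/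
def curve (k : K) : WeierstrassCurve K where
  a₁ := 0
  a₂ := sideA k * sideB k + sideB k * sideC k + sideA k * sideC k
  a₃ := 0
  a₄ := sideA k * sideB k * sideC k * (sideA k + sideB k + sideC k)
  a₆ := (sideA k * sideB k * sideC k) ^ 2

/-- The affine equation of the curve in factored form. -/
theorem curve_equation_iff (k x y : K) :
    (curve k).toAffine.Equation x y ↔
      y ^ 2 = (x + sideA k * sideB k) * (x + sideB k * sideC k) * (x + sideA k * sideC k) := by
  rw [WeierstrassCurve.Affine.equation_iff]
  simp only [curve]
  constructor <;> intro h <;> linear_combination h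

end HeronCurve

end

open Polynomial

namespace HeronCurve

/-! ### Discriminant and duplication formula -/

section Algebra

variable {K : Type*} [Field K]

/-! The argument is 2-adic, along any embedding `φ` of the base field in `ℚ_[2]`. Let `α`, `β`, `γ`
be the differences between `x` and the abscissas of the three 2-torsion points. Doubling sends `α`
to `(αβ + αγ - βγ)² / (4αβγ)` (`add_self_eq`). For `2P` the differences are the squares of the
tangent lengths `(k + 2)²`, `(k - 2)³ / 2`, `4k(k - 2)` of the triangle with sides `a`, `b`, `c`,
and exactly one of these is strictly smallest 2-adically (`norm_tangent_min`). This forces `4P` so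
close to the origin that `x + ab` dominates the gaps between the 2-torsion points
(`norm_lt_of_mul_eq`). From there each doubling multiplies `‖x + ab‖` by exactly 4
(`norm_eq_of_mul_eq`), so the points `2ⁿ • 4P` are distinct and `P` has infinite order.

Both fields embed in `ℚ_[2]`: `ℚ` canonically, `ℚ(k)` by sending `k` to a transcendental 2-adic
number. It remains to check that the factors of the discriminant do not vanish. -/

theorem curve_Δ (k : K) :
    (curve k).Δ = 16 * (sideA k * sideB k * sideC k) ^ 2 *
      ((sideA k - sideB k) * (sideB k - sideC k) * (sideA k - sideC k)) ^ 2 := by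
  simp only [WeierstrassCurve.Δ, WeierstrassCurve.b₂, WeierstrassCurve.b₄, WeierstrassCurve.b₆,
    WeierstrassCurve.b₈, curve]
  ring

theorem side_ne_zero [CharZero K] {k : K} (h₀ : k ≠ 0) (h₂ : k ≠ 2) (h₂' : k ≠ -2)
    (ha : 5 * k ^ 2 - 4 * k + 4 ≠ 0) (hb : k ^ 2 - 4 * k + 20 ≠ 0) :
    sideA k * sideB k * sideC k ≠ 0 := by
  have h₁ : k - 2 ≠ 0 := sub_ne_zero.2 h₂
  have h₁' : k + 2 ≠ 0 := fun h => h₂' (eq_neg_of_add_eq_zero_left h)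
  have hc : sideC k = (k + 2) ^ 2 * (k - 2) / 2 := by rw [sideC]; ring
  rw [hc, sideA, sideB]
  have : (2 : K) ≠ 0 := two_ne_zero
  positivity

theorem isElliptic_curve [CharZero K] {k : K} (habc : sideA k * sideB k * sideC k ≠ 0)
    (h₂ : k ≠ 2) (hab : k ^ 2 - 12 * k + 4 ≠ 0) (hbc : 3 * k ^ 2 - 12 * k - 4 ≠ 0)
    (hac : k ^ 3 - 8 * k ^ 2 + 4 * k - 16 ≠ 0) : (curve k).IsElliptic := by
  have h₁ : k - 2 ≠ 0 := sub_ne_zero.2 h₂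
  have e₁ : sideA k - sideB k = -((k - 2) * (k ^ 2 - 12 * k + 4)) / 2 := by
    rw [sideA, sideB]; field_simp; ring
  have e₂ : sideB k - sideC k = -(3 * k ^ 2 - 12 * k - 4) := by
    rw [sideB, sideC]; field_simp; ring
  have e₃ : sideA k - sideC k = -(k ^ 3 - 8 * k ^ 2 + 4 * k - 16) / 2 := by
    rw [sideA, sideC]; field_simp; ring
  rw [WeierstrassCurve.isElliptic_iff, isUnit_iff_ne_zero, curve_Δ, e₁, e₂, e₃]
  have h : (2 : K) ≠ 0 := two_ne_zero
  have h' : (16 : K) ≠ 0 := by norm_num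
  exact mul_ne_zero (mul_ne_zero h' (pow_ne_zero _ habc)) (pow_ne_zero _ (mul_ne_zero (mul_ne_zero
    (div_ne_zero (neg_ne_zero.2 (mul_ne_zero h₁ hab)) h) (neg_ne_zero.2 hbc))
    (div_ne_zero (neg_ne_zero.2 hac) h)))

theorem nonsingular_of_ne_zero [CharZero K] {k x y : K} (h : (curve k).toAffine.Equation x y)
    (hy : y ≠ 0) : (curve k).toAffine.Nonsingular x y := by
  rw [WeierstrassCurve.Affine.nonsingular_iff]
  refine ⟨h, Or.inr ?_⟩
  simp only [curve]
  intro h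
  refine hy (self_eq_neg.1 ?_)
  linear_combination h

/-- The duplication formula in terms of the distances of `x` to the three `2`-torsion points. -/
theorem add_self_eq [DecidableEq K] [CharZero K] {k x y : K}
    (h : (curve k).toAffine.Nonsingular x y) (hy : y ≠ 0) :
    ∃ (x' y' : K) (h' : (curve k).toAffine.Nonsingular x' y'),
      WeierstrassCurve.Affine.Point.some x y h + WeierstrassCurve.Affine.Point.some x y h =
        WeierstrassCurve.Affine.Point.some x' y' h' ∧
      ∀ α β γ : K, α = x + sideA k * sideB k → β = x + sideB k * sideC k →
        γ = x + sideA k * sideC k →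
        (x' + sideA k * sideB k) * (4 * (α * β * γ)) = (α * β + α * γ - β * γ) ^ 2 := by
  have hne : y ≠ (curve k).toAffine.negY x y := by
    simp only [WeierstrassCurve.Affine.negY, curve]
    intro h
    refine hy (self_eq_neg.1 ?_)
    linear_combination h
  refine ⟨_, _, _, WeierstrassCurve.Affine.Point.add_self_of_Y_ne hne, ?_⟩
  rintro α β γ rfl rfl rfl
  have heq := (curve_equation_iff k x y).1 h.1
  rw [WeierstrassCurve.Affine.slope_of_Y_ne rfl hne, ← heq]
  simp only [WeierstrassCurve.Affine.addX, WeierstrassCurve.Affine.negY, curve]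
  have h2 : y - (-y - 0 * x - 0) = 2 * y := by ring
  rw [h2]
  field_simp
  generalize sideA k = a at *
  generalize sideB k = b at *
  generalize sideC k = c at *
  linear_combination (-16 * (2 * x + b * c + a * c)) * heq

end Algebra

/-! ### Ultrametric estimates in `ℚ_[2]` -/

section Norm

theorem norm_two : ‖(2 : ℚ_[2])‖ = 1 / 2 := by
  simpa using Padic.norm_p (p := 2)

theorem norm_four : ‖(4 : ℚ_[2])‖ = 1 / 4 := by
  rw [show (4 : ℚ_[2]) = 2 * 2 by norm_num, norm_mul, norm_two]; norm_num

theorem norm_add_eq_left {a b : ℚ_[2]} (h : ‖b‖ < ‖a‖) : ‖a + b‖ = ‖a‖ := by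
  rw [Padic.add_eq_max_of_ne h.ne', max_eq_left h.le]

theorem norm_sub_eq_left {a b : ℚ_[2]} (h : ‖b‖ < ‖a‖) : ‖a - b‖ = ‖a‖ := by
  rw [sub_eq_add_neg, norm_add_eq_left (by rwa [norm_neg])]

theorem norm_sub_le_max (a b : ℚ_[2]) : ‖a - b‖ ≤ max ‖a‖ ‖b‖ := by
  simpa [sub_eq_add_neg] using Padic.nonarchimedean a (-b)

theorem norm_le_half {x : ℚ_[2]} (h : ‖x‖ < 1) : ‖x‖ ≤ 1 / 2 := by
  have := (Padic.norm_lt_pow_iff_norm_le_pow_sub_one x 0).1 (by simpa using h)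
  norm_num at this
  simpa using this

theorem norm_lt_one_or_norm_sub_one_lt_one {x : ℚ_[2]} (h : ‖x‖ ≤ 1) :
    ‖x‖ < 1 ∨ ‖x - 1‖ < 1 := by
  obtain ⟨n, hn, hx⟩ := PadicInt.exists_mem_range (p := 2) (⟨x, h⟩ : ℤ_[2])
  rw [IsLocalRing.mem_maximalIdeal, PadicInt.mem_nonunits, PadicInt.norm_def] at hx
  change ‖x - ((n : ℤ_[2]) : ℚ_[2])‖ < 1 at hx
  interval_cases n
  · left; simpa using hx
  · right; simpa using hx

/-- If one of the distances `α`, `β`, `γ` of `x` to the `2`-torsion points is strictly smallest, then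
the distance `A` after doubling exceeds the distances between the `2`-torsion points. -/
theorem norm_lt_of_mul_eq {α β γ A : ℚ_[2]} (hα : α ≠ 0) (hβ : β ≠ 0) (hγ : γ ≠ 0)
    (hmin : (‖α‖ < ‖β‖ ∧ ‖α‖ < ‖γ‖) ∨ (‖β‖ < ‖α‖ ∧ ‖β‖ < ‖γ‖) ∨ (‖γ‖ < ‖α‖ ∧ ‖γ‖ < ‖β‖))
    (hA : A * (4 * (α * β * γ)) = (α * β + α * γ - β * γ) ^ 2) :
    ‖α - β‖ < ‖A‖ ∧ ‖α - γ‖ < ‖A‖ := by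
  have a0 := norm_pos_iff.2 hα
  have b0 := norm_pos_iff.2 hβ
  have c0 := norm_pos_iff.2 hγ
  have hN := congrArg norm hA
  rw [norm_mul, norm_mul, norm_mul, norm_mul, norm_pow, norm_four] at hN
  suffices H : ‖α‖ < ‖A‖ ∧ ‖β‖ < ‖A‖ ∧ ‖γ‖ < ‖A‖ from
    ⟨(norm_sub_le_max _ _).trans_lt (max_lt H.1 H.2.1),
      (norm_sub_le_max _ _).trans_lt (max_lt H.1 H.2.2)⟩
  -- With `c` the smallest norm, the product of the two larger ones dominates the numerator, so `r =
  -- 4ab / c`, which exceeds both `a` and `b`.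
  have key : ∀ a b c r : ℝ, 0 < a → 0 < b → 0 < c → c < a → c < b →
      r * (1 / 4 * (a * b * c)) = (a * b) ^ 2 → a < r ∧ b < r ∧ c < r := by
    intro a b c r ha hb hc hca hcb h
    have h1 : r * c = 4 * (a * b) := by
      have : a * b ≠ 0 := by positivity
      apply mul_left_cancel₀ this
      linear_combination 4 * h
    have h2 : a < r := by
      by_contra! hr
      nlinarith [mul_le_mul_of_nonneg_right hr hc.le, mul_lt_mul_of_pos_left hcb ha, mul_pos ha hb]
    have h3 : b < r := by
      by_contra! hr
      nlinarith [mul_le_mul_of_nonneg_right hr hc.le, mul_lt_mul_of_pos_left hca hb, mul_pos ha hb]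
    exact ⟨h2, h3, hca.trans h2⟩
  rcases hmin with ⟨h1, h2⟩ | ⟨h1, h2⟩ | ⟨h1, h2⟩
  · have e : ‖α * β + α * γ - β * γ‖ = ‖β‖ * ‖γ‖ := by
      rw [norm_sub_rev, norm_sub_eq_left, norm_mul]
      refine (Padic.nonarchimedean _ _).trans_lt (max_lt ?_ ?_) <;> simp only [norm_mul]
      · rw [mul_comm]; gcongr
      gcongr
    rw [e] at hN
    obtain ⟨h, h', h''⟩ := key ‖β‖ ‖γ‖ ‖α‖ ‖A‖ b0 c0 a0 h1 h2 (by rw [← hN]; ring)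
    exact ⟨h'', h, h'⟩
  · have e : ‖α * β + α * γ - β * γ‖ = ‖α‖ * ‖γ‖ := by
      rw [add_comm, add_sub_assoc, norm_add_eq_left, norm_mul]
      refine (norm_sub_le_max _ _).trans_lt (max_lt ?_ ?_) <;> simp only [norm_mul] <;> gcongr
    rw [e] at hN
    obtain ⟨h, h', h''⟩ := key ‖α‖ ‖γ‖ ‖β‖ ‖A‖ a0 c0 b0 h1 h2 (by rw [← hN]; ring)
    exact ⟨h, h'', h'⟩
  · have e : ‖α * β + α * γ - β * γ‖ = ‖α‖ * ‖β‖ := by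
      rw [add_sub_assoc, norm_add_eq_left, norm_mul]
      refine (norm_sub_le_max _ _).trans_lt (max_lt ?_ ?_) <;> simp only [norm_mul]
      · gcongr
      · rw [mul_comm]; gcongr
    rw [e] at hN
    exact key ‖α‖ ‖β‖ ‖γ‖ ‖A‖ a0 b0 c0 h1 h2 hN

/-- All three norms agree, and the numerator is the square of `α² - (α - β)(α - γ)`, where `α²`
dominates; the factor 4 is `1 / ‖4‖`. -/
theorem norm_eq_of_mul_eq {α β γ A : ℚ_[2]} (hβ : ‖α - β‖ < ‖α‖) (hγ : ‖α - γ‖ < ‖α‖)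
    (hA : A * (4 * (α * β * γ)) = (α * β + α * γ - β * γ) ^ 2) :
    ‖A‖ = 4 * ‖α‖ := by
  have a0 : 0 < ‖α‖ := (norm_nonneg _).trans_lt hβ
  have eb : ‖β‖ = ‖α‖ := by rw [← norm_sub_eq_left hβ, sub_sub_cancel]
  have ec : ‖γ‖ = ‖α‖ := by rw [← norm_sub_eq_left hγ, sub_sub_cancel]
  have e : ‖α * β + α * γ - β * γ‖ = ‖α‖ ^ 2 := by
    rw [show α * β + α * γ - β * γ = α ^ 2 - (α - β) * (α - γ) by ring, norm_sub_eq_left, norm_pow]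
    rw [norm_mul, norm_pow, sq]
    gcongr
  have hN := congrArg norm hA
  rw [norm_mul, norm_mul, norm_mul, norm_mul, norm_pow, norm_four, e, eb, ec] at hN
  have : ‖α‖ ^ 3 ≠ 0 := by positivity
  apply mul_left_cancel₀ this
  linear_combination 4 * hN

/-- Among the three tangent lengths of the triangle, one is strictly smallest `2`-adically. -/
theorem norm_tangent_min {k : ℚ_[2]} (h₀ : k ≠ 0) (h₂ : k ≠ 2) :
    (‖(k + 2) ^ 2‖ < ‖(k - 2) ^ 3 / 2‖ ∧ ‖(k + 2) ^ 2‖ < ‖4 * k * (k - 2)‖) ∨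
    (‖(k - 2) ^ 3 / 2‖ < ‖(k + 2) ^ 2‖ ∧ ‖(k - 2) ^ 3 / 2‖ < ‖4 * k * (k - 2)‖) ∨
    (‖4 * k * (k - 2)‖ < ‖(k + 2) ^ 2‖ ∧ ‖4 * k * (k - 2)‖ < ‖(k - 2) ^ 3 / 2‖) := by
  have k0 := norm_pos_iff.2 h₀
  have d0 : 0 < ‖k - 2‖ := norm_pos_iff.2 (sub_ne_zero.2 h₂)
  simp only [norm_mul, norm_div, norm_pow, norm_two, norm_four]
  rcases lt_trichotomy ‖k‖ (1 / 2) with h | h | h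
  · have hD : ‖k - 2‖ = 1 / 2 := by
      rw [norm_sub_rev, norm_sub_eq_left, norm_two]; rwa [norm_two]
    have hS : ‖k + 2‖ = 1 / 2 := by
      rw [add_comm, norm_add_eq_left, norm_two]; rwa [norm_two]
    rw [hD, hS]
    right; right
    constructor <;> linarith
  -- Here `k / 2` is a unit, hence odd, so `m = (k + 2) / 4` is a 2-adic integer with `m - 1 = (k -
  -- 2) / 4`. The parity of `m` decides which tangent length is smallest.
  · have h1 : ‖k / 2‖ = 1 := by rw [norm_div, h, norm_two]; norm_num
    have h2 : ‖k / 2 - 1‖ ≤ 1 / 2 := by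
      rcases norm_lt_one_or_norm_sub_one_lt_one h1.le with h' | h'
      · exact absurd h1 h'.ne
      · exact norm_le_half h'
    have h3 : ‖(k + 2) / 4‖ ≤ 1 := by
      rw [show (k + 2) / 4 = (k / 2 - 1) / 2 + 1 by ring]
      refine (Padic.nonarchimedean _ _).trans (max_le ?_ (by simp))
      rw [norm_div, norm_two]; linarith
    have e1 : ‖k + 2‖ = ‖(k + 2) / 4‖ / 4 := by rw [norm_div, norm_four]; ring
    have e2 : ‖k - 2‖ = ‖(k + 2) / 4 - 1‖ / 4 := by
      rw [show (k + 2) / 4 - 1 = (k - 2) / 4 by ring, norm_div, norm_four]; ring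
    rcases norm_lt_one_or_norm_sub_one_lt_one h3 with h' | h'
    · have hS : ‖k + 2‖ ≤ 1 / 8 := by rw [e1]; linarith [norm_le_half h']
      have hD : ‖k - 2‖ = 1 / 4 := by
        rw [e2, norm_sub_rev, norm_sub_eq_left (by rwa [norm_one]), norm_one]
      rw [hD, h]
      left
      have := pow_le_pow_left₀ (norm_nonneg _) hS 2
      constructor <;> linarith
    · have hD : ‖k - 2‖ ≤ 1 / 8 := by rw [e2]; linarith [norm_le_half h']
      have hS : ‖k + 2‖ = 1 / 4 := by
        rw [e1, ← sub_add_cancel ((k + 2) / 4) 1, add_comm, norm_add_eq_left (by rwa [norm_one]), norm_one]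
      rw [hS, h]
      right; left
      have hD2 := pow_le_pow_left₀ (norm_nonneg _) hD 2
      have : ‖k - 2‖ ^ 3 ≤ (1 / 64) * ‖k - 2‖ := by
        rw [pow_succ]; gcongr; linarith
      constructor <;> linarith
  · have hD : ‖k - 2‖ = ‖k‖ := norm_sub_eq_left (by rwa [norm_two])
    have hS : ‖k + 2‖ = ‖k‖ := norm_add_eq_left (by rwa [norm_two])
    rw [hD, hS]
    right; right
    have : 0 < ‖k‖ ^ 2 := by positivity
    have : (1 / 2) * ‖k‖ ^ 2 < ‖k‖ ^ 3 := by rw [pow_succ ‖k‖ 2, mul_comm]; gcongr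
    constructor <;> nlinarith

end Norm

/-! ### Points near the origin and infinite order -/

section Order

variable {K : Type*} [Field K] [DecidableEq K] [CharZero K] (φ : K →+* ℚ_[2]) {k : K}


/-- The point is affine, with `x`-coordinate at distance `r` from the `2`-torsion point `(-ab, 0)`,
and `2`-adically this exceeds the distances of `(-ab, 0)` to the other `2`-torsion points. -/
def IsNearZero (P : (curve k).toAffine.Point) (r : ℝ) : Prop :=
  ∃ (x y : K) (h : (curve k).toAffine.Nonsingular x y),
    P = WeierstrassCurve.Affine.Point.some x y h ∧ ‖φ (x + sideA k * sideB k)‖ = r ∧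
    ‖φ (sideA k * sideB k) - φ (sideB k * sideC k)‖ < r ∧
    ‖φ (sideA k * sideB k) - φ (sideA k * sideC k)‖ < r

variable {φ}

theorem IsNearZero.add_self {P : (curve k).toAffine.Point} {r : ℝ} (hP : IsNearZero φ P r) :
    IsNearZero φ (P + P) (4 * r) := by
  obtain ⟨x, y, h, rfl, rfl, hβ, hγ⟩ := hP
  have r0 := (norm_nonneg _).trans_lt hβ
  have eβ : φ (x + sideA k * sideB k) - φ (x + sideB k * sideC k) =
    φ (sideA k * sideB k) - φ (sideB k * sideC k) := by simp only [map_add]; ring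
  have eγ : φ (x + sideA k * sideB k) - φ (x + sideA k * sideC k) =
    φ (sideA k * sideB k) - φ (sideA k * sideC k) := by simp only [map_add]; ring
  have hy : y ≠ 0 := by
    rintro rfl
    have heq := congrArg φ ((curve_equation_iff k x 0).1 h.1)
    rw [map_pow, map_zero, zero_pow two_ne_zero, map_mul, map_mul, eq_comm, mul_eq_zero,
      mul_eq_zero] at heq
    rcases heq with (e | e) | e
    · rw [e, norm_zero] at r0; exact r0.false
    · rw [← eβ, e, sub_zero] at hβ; exact hβ.false
    · rw [← eγ, e, sub_zero] at hγ; exact hγ.false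
  obtain ⟨x', y', h', hadd, hx'⟩ := add_self_eq h hy
  have hx := congrArg φ (hx' _ _ _ rfl rfl rfl)
  rw [map_mul, map_mul, map_pow, map_sub, map_add φ (_ * _), map_mul φ (_ * _), map_mul φ (_ + _),
    map_mul φ (_ + _), map_mul φ (_ + _), map_ofNat] at hx
  have hnorm := norm_eq_of_mul_eq (by rwa [eβ]) (by rwa [eγ]) hx
  exact ⟨x', y', h', hadd, hnorm, by linarith, by linarith⟩

theorem IsNearZero.not_isOfFinAddOrder {P : (curve k).toAffine.Point} {r : ℝ}
    (hP : IsNearZero φ P r) : ¬ IsOfFinAddOrder P := by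
  have r0 : 0 < r := by
    obtain ⟨x, y, h, -, -, hβ, -⟩ := hP
    exact (norm_nonneg _).trans_lt hβ
  have hpow : ∀ n : ℕ, IsNearZero φ (2 ^ n • P) (4 ^ n * r) := by
    intro n
    induction n with
    | zero => simpa using hP
    | succ n ih =>
      rw [pow_succ, mul_nsmul, two_nsmul, pow_succ', mul_assoc]
      exact ih.add_self
  rw [← finite_multiples]
  refine Set.infinite_of_injective_forall_mem (f := fun n : ℕ => 2 ^ n • P) ?_ fun n => ⟨2 ^ n, rfl⟩
  intro m n hmn
  obtain ⟨x, y, h, e, hr, -⟩ := hpow m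
  obtain ⟨x', y', h', e', hr', -⟩ := hpow n
  have hx : x = x' := by
    have := e.symm.trans (hmn.trans e')
    simp only [WeierstrassCurve.Affine.Point.some.injEq] at this
    exact this.1
  subst hx
  rw [hr] at hr'
  exact pow_right_injective₀ (by norm_num) (by norm_num) (mul_right_cancel₀ r0.ne' hr')

theorem not_isOfFinAddOrder_some (φ : K →+* ℚ_[2]) (h₀ : k ≠ 0) (h₂ : k ≠ 2) (h₂' : k ≠ -2)
    (habc : sideA k * sideB k * sideC k ≠ 0)
    (h : (curve k).toAffine.Nonsingular 0 (sideA k * sideB k * sideC k)) :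
    ¬ IsOfFinAddOrder (WeierstrassCurve.Affine.Point.some _ _ h) := by
  obtain ⟨x, y, h', hadd, hx⟩ := add_self_eq h habc
  replace hx := hx _ _ _ rfl rfl rfl
  have h1 : k - 2 ≠ 0 := sub_ne_zero.2 h₂
  have h1' : k + 2 ≠ 0 := fun h => h₂' (eq_neg_of_add_eq_zero_left h)
  -- At `x = 0` the duplication formula collapses to `((a + b - c) / 2)²`.
  have hw : x + sideA k * sideB k = ((k + 2) ^ 2) ^ 2 := by
    have h4 : 4 * (sideA k * sideB k * sideC k) ^ 2 ≠ 0 := by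
      have : (4 : K) ≠ 0 := by norm_num
      positivity
    have hs : sideA k + sideB k - sideC k = 2 * (k + 2) ^ 2 := by
      simp only [sideA, sideB, sideC]; field_simp; ring
    apply mul_right_cancel₀ h4
    linear_combination hx + (sideA k * sideB k * sideC k) ^ 2 *
      (sideA k + sideB k - sideC k + 2 * (k + 2) ^ 2) * hs
  have hu : x + sideB k * sideC k = ((k - 2) ^ 3 / 2) ^ 2 := by
    rw [← sub_eq_iff_eq_add.2 hw.symm]; simp only [sideA, sideB, sideC]; field_simp; ring
  have hv : x + sideA k * sideC k = (4 * k * (k - 2)) ^ 2 := by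
    rw [← sub_eq_iff_eq_add.2 hw.symm]; simp only [sideA, sideB, sideC]; field_simp; ring
  have hy : y ≠ 0 := by
    rintro rfl
    have := (curve_equation_iff k x 0).1 h'.1
    rw [hw, hu, hv] at this
    have h2 : (2 : K) ≠ 0 := two_ne_zero
    have h4 : (4 : K) ≠ 0 := by norm_num
    have : ((k + 2) ^ 2) ^ 2 * ((k - 2) ^ 3 / 2) ^ 2 * (4 * k * (k - 2)) ^ 2 ≠ 0 := by positivity
    simp_all
  obtain ⟨x', y', h'', hadd', hx'⟩ := add_self_eq h' hy
  have hA := congrArg φ (hx' _ _ _ rfl rfl rfl)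
  rw [hw, hu, hv] at hA
  have hmin := norm_tangent_min (k := φ k) (by simpa using h₀)
    (by simpa [map_ofNat] using φ.injective.ne h₂)
  have h0 : φ k ≠ 0 := by simpa using h₀
  have hk1 : φ k - 2 ≠ 0 := by simpa [map_ofNat] using (map_ne_zero φ).2 h1
  have hk2 : φ k + 2 ≠ 0 := by simpa [map_ofNat] using (map_ne_zero φ).2 h1'
  have hsq : ∀ a b : ℚ_[2], ‖a‖ < ‖b‖ → ‖a ^ 2‖ < ‖b ^ 2‖ := fun a b hab => by
    rw [norm_pow, norm_pow]; gcongr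
  have hlt := norm_lt_of_mul_eq (α := ((φ k + 2) ^ 2) ^ 2) (β := ((φ k - 2) ^ 3 / 2) ^ 2)
    (γ := (4 * φ k * (φ k - 2)) ^ 2) (A := φ (x' + sideA k * sideB k)) (pow_ne_zero _ (pow_ne_zero _ hk2))
    (pow_ne_zero _ (div_ne_zero (pow_ne_zero _ hk1) two_ne_zero))
    (pow_ne_zero _ (mul_ne_zero (mul_ne_zero (by norm_num) h0) hk1))
    (hmin.imp (fun h => ⟨hsq _ _ h.1, hsq _ _ h.2⟩) (Or.imp (fun h => ⟨hsq _ _ h.1, hsq _ _ h.2⟩)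
      (fun h => ⟨hsq _ _ h.1, hsq _ _ h.2⟩))) (by simpa [map_ofNat] using hA)
  have eβ : φ (sideA k * sideB k) - φ (sideB k * sideC k) =
      ((φ k + 2) ^ 2) ^ 2 - ((φ k - 2) ^ 3 / 2) ^ 2 := by
    have := congrArg φ (congrArg₂ (· - ·) hw hu)
    simp only [add_sub_add_left_eq_sub] at this
    simpa [map_ofNat] using this
  have eγ : φ (sideA k * sideB k) - φ (sideA k * sideC k) =
      ((φ k + 2) ^ 2) ^ 2 - (4 * φ k * (φ k - 2)) ^ 2 := by
    have := congrArg φ (congrArg₂ (· - ·) hw hv)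
    simp only [add_sub_add_left_eq_sub] at this
    simpa [map_ofNat] using this
  have hnear : IsNearZero φ (WeierstrassCurve.Affine.Point.some _ _ h' +
      WeierstrassCurve.Affine.Point.some _ _ h') ‖φ (x' + sideA k * sideB k)‖ :=
    ⟨x', y', h'', hadd', rfl, by rw [eβ]; exact hlt.1, by rw [eγ]; exact hlt.2⟩
  -- `hnear` concerns `4P`, which would be torsion if `P` were.
  intro hfin
  rw [← hadd] at hnear
  refine hnear.not_isOfFinAddOrder ?_
  simpa only [two_nsmul] using (hfin.nsmul (n := 2)).nsmul (n := 2)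

/-- Ellipticity, infinite order and positive rank for a parameter in a field that embeds in `ℚ₂`. -/
theorem rank_pos (φ : K →+* ℚ_[2]) (h₀ : k ≠ 0) (h₂ : k ≠ 2) (h₂' : k ≠ -2)
    (ha : 5 * k ^ 2 - 4 * k + 4 ≠ 0) (hb : k ^ 2 - 4 * k + 20 ≠ 0)
    (hab : k ^ 2 - 12 * k + 4 ≠ 0) (hbc : 3 * k ^ 2 - 12 * k - 4 ≠ 0)
    (hac : k ^ 3 - 8 * k ^ 2 + 4 * k - 16 ≠ 0) :
    (curve k).IsElliptic ∧
      (∃ h : (curve k).toAffine.Nonsingular 0 (sideA k * sideB k * sideC k),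
        ¬ IsOfFinAddOrder (WeierstrassCurve.Affine.Point.some _ _ h)) ∧
      1 ≤ Module.rank ℤ (curve k).toAffine.Point := by
  have habc := side_ne_zero h₀ h₂ h₂' ha hb
  have h : (curve k).toAffine.Nonsingular 0 (sideA k * sideB k * sideC k) :=
    nonsingular_of_ne_zero ((curve_equation_iff _ _ _).2 (by ring)) habc
  have hord := not_isOfFinAddOrder_some φ h₀ h₂ h₂' habc h
  refine ⟨isElliptic_curve habc h₂ hab hbc hac, ⟨h, hord⟩, ?_⟩
  have hli : LinearIndependent ℤ
      fun _ : Unit => (WeierstrassCurve.Affine.Point.some _ _ h : (curve k).toAffine.Point) := by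
    rw [Fintype.linearIndependent_iff]
    intro g hg i
    by_contra hi
    refine hord (isOfFinAddOrder_iff_zsmul_eq_zero.2 ⟨g i, hi, ?_⟩)
    simpa using hg
  simpa using hli.cardinal_lift_le_rank

end Order

/-! ### Embedding `ℚ(k)` in `ℚ_[2]`, and nonvanishing of the discriminant factors -/

theorem exists_transcendental_padic : ∃ t : ℚ_[2], Transcendental ℚ t := by
  by_contra! h
  have hc := Algebraic.countable ℚ ℚ_[2]
  have hu : {x : ℚ_[2] | IsAlgebraic ℚ x} = Set.univ :=
    Set.eq_univ_of_forall fun x => not_not.1 (h x)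
  rw [hu, Set.countable_univ_iff] at hc
  have h1 := continuum_le_cardinal_of_nontriviallyNormedField ℚ_[2]
  have h2 := Cardinal.mk_le_aleph0 (α := ℚ_[2])
  exact absurd (h1.trans h2) (not_le.2 Cardinal.aleph0_lt_continuum)

theorem exists_ratFunc_ringHom_padic : Nonempty (RatFunc ℚ →+* ℚ_[2]) := by
  obtain ⟨t, ht⟩ := exists_transcendental_padic
  have hinj : Function.Injective (Polynomial.aeval t : ℚ[X] →ₐ[ℚ] ℚ_[2]) :=
    transcendental_iff_injective.1 ht
  exact ⟨IsFractionRing.lift (A := ℚ[X]) (g := (Polynomial.aeval t : ℚ[X] →ₐ[ℚ] ℚ_[2]).toRingHom)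
    hinj⟩

theorem aeval_ratFunc_X_ne_zero (p : ℚ[X]) (q : ℚ) (h : p.eval q ≠ 0) :
    Polynomial.aeval (RatFunc.X : RatFunc ℚ) p ≠ 0 := by
  intro h0
  rw [← RatFunc.algebraMap_X, Polynomial.aeval_algebraMap_apply, aeval_X_left_apply] at h0
  have : p = 0 := by simpa using h0
  simp [this] at h

theorem exists_int_of_cubic_eq_zero {k : ℚ} {p q r : ℤ}
    (h : k ^ 3 + p * k ^ 2 + q * k + r = 0) : ∃ n : ℤ, k = n := by
  have hint : IsIntegral ℤ k := by
    refine ⟨X ^ 3 + C p * X ^ 2 + C q * X + C r, by monicity!, ?_⟩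
    simp only [eval₂_add, eval₂_mul, eval₂_pow, eval₂_X, eval₂_C]
    exact_mod_cast h
  obtain ⟨n, hn⟩ := IsIntegrallyClosed.isIntegral_iff.1 hint
  exact ⟨n, by simpa using hn.symm⟩

theorem abs_le_of_dvd {n c : ℤ} (h : n ∣ c) (hc : 0 < c) (hc' : c ≤ 16) : |n| ≤ 16 :=
  (Int.le_of_dvd hc ((abs_dvd n c).2 h)).trans hc'

theorem quadratic_ab_ne_zero (k : ℚ) : k ^ 2 - 12 * k + 4 ≠ 0 := by
  intro h
  -- The quadratic is multiplied by `k` to fit the cubic lemma, hence `r = 0`.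
  obtain ⟨n, rfl⟩ := exists_int_of_cubic_eq_zero (k := k) (p := -12) (q := 4) (r := 0)
    (by push_cast; linear_combination k * h)
  have h' : n * (12 - n) = 4 := by
    have : ((n * (12 - n) : ℤ) : ℚ) = (4 : ℤ) := by push_cast; linear_combination -h
    exact_mod_cast this
  obtain ⟨h1, h2⟩ := abs_le.1 (abs_le_of_dvd ⟨_, h'.symm⟩ (by norm_num) (by norm_num))
  interval_cases n <;> omega

theorem quadratic_bc_ne_zero (k : ℚ) : 3 * k ^ 2 - 12 * k - 4 ≠ 0 := by
  intro h
  -- Passing to `3k` makes the polynomial monic.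
  obtain ⟨n, hn⟩ := exists_int_of_cubic_eq_zero (k := 3 * k) (p := -12) (q := -12) (r := 0)
    (by push_cast; linear_combination 9 * k * h)
  have h' : n * (n - 12) = 12 := by
    have : ((n * (n - 12) : ℤ) : ℚ) = (12 : ℤ) := by
      push_cast; rw [← hn]; linear_combination 3 * h
    exact_mod_cast this
  obtain ⟨h1, h2⟩ := abs_le.1 (abs_le_of_dvd ⟨_, h'.symm⟩ (by norm_num) (by norm_num))
  interval_cases n <;> omega

theorem cubic_ac_ne_zero (k : ℚ) : k ^ 3 - 8 * k ^ 2 + 4 * k - 16 ≠ 0 := by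
  intro h
  obtain ⟨n, rfl⟩ := exists_int_of_cubic_eq_zero (k := k) (p := -8) (q := 4) (r := -16)
    (by push_cast; linear_combination h)
  have h' : n * (n ^ 2 - 8 * n + 4) = 16 := by
    have : ((n * (n ^ 2 - 8 * n + 4) : ℤ) : ℚ) = (16 : ℤ) := by push_cast; linear_combination h
    exact_mod_cast this
  obtain ⟨h1, h2⟩ := abs_le.1 (abs_le_of_dvd ⟨_, h'.symm⟩ (by norm_num) (by norm_num))
  interval_cases n <;> omega

end HeronCurve

theorem corollary2p2 [DecidableEq (RatFunc ℚ)] :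
    -- the curve over the function field `ℚ(k)`, with `k` an indeterminate
    ((HeronCurve.curve (RatFunc.X : RatFunc ℚ)).IsElliptic ∧
      (∃ h : (HeronCurve.curve (RatFunc.X : RatFunc ℚ)).toAffine.Nonsingular 0
          (HeronCurve.sideA RatFunc.X * HeronCurve.sideB RatFunc.X * HeronCurve.sideC RatFunc.X),
        ¬ IsOfFinAddOrder (WeierstrassCurve.Affine.Point.some _ _ h)) ∧
      1 ≤ Module.rank ℤ (HeronCurve.curve (RatFunc.X : RatFunc ℚ)).toAffine.Point) ∧
    -- every member of the family over `ℚ`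
    (∀ k : ℚ, k ≠ 0 → k ≠ 2 → k ≠ -2 →
      (HeronCurve.curve k).IsElliptic ∧
      (∃ h : (HeronCurve.curve k).toAffine.Nonsingular 0
          (HeronCurve.sideA k * HeronCurve.sideB k * HeronCurve.sideC k),
        ¬ IsOfFinAddOrder (WeierstrassCurve.Affine.Point.some _ _ h)) ∧
      1 ≤ Module.rank ℤ (HeronCurve.curve k).toAffine.Point) := by 
  constructor
  · obtain ⟨φ⟩ := HeronCurve.exists_ratFunc_ringHom_padic
    have hX := HeronCurve.aeval_ratFunc_X_ne_zero
    refine HeronCurve.rank_pos φ RatFunc.X_ne_zero (fun h => ?_) (fun h => ?_) ?_ ?_ ?_ ?_ ?_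
    -- Each factor has nonzero constant term, so evaluation at 0 shows that it is a nonzero
    -- polynomial.
    · exact hX (X - C 2) 0 (by simp) (by simp [h])
    · exact hX (X + C 2) 0 (by simp) (by simp [h])
    · exact fun h => hX (C 5 * X ^ 2 - C 4 * X + C 4) 0 (by simp) (Eq.trans (by simp [map_ofNat]) h)
    · exact fun h => hX (X ^ 2 - C 4 * X + C 20) 0 (by simp) (Eq.trans (by simp [map_ofNat]) h)
    · exact fun h => hX (X ^ 2 - C 12 * X + C 4) 0 (by simp) (Eq.trans (by simp [map_ofNat]) h)
    · exact fun h => hX (C 3 * X ^ 2 - C 12 * X - C 4) 0 (by simp) (Eq.trans (by simp [map_ofNat]) h)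
    · exact fun h => hX (X ^ 3 - C 8 * X ^ 2 + C 4 * X - C 16) 0 (by simp) (Eq.trans (by simp [map_ofNat]) h)
  · intro k h₀ h₂ h₂'
    refine HeronCurve.rank_pos (algebraMap ℚ ℚ_[2]) h₀ h₂ h₂' ?_ ?_ ?_ ?_ ?_
    · nlinarith [sq_nonneg (5 * k - 2)]
    · nlinarith [sq_nonneg (k - 2)]
    · exact HeronCurve.quadratic_ab_ne_zero k
    · exact HeronCurve.quadratic_bc_ne_zero k
    · exact HeronCurve.cubic_ac_ne_zero k
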